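/- Fix $\sigma>0$. Let $\Phi$ be the standard normal distribution function and let $f_V(z)=\frac{1}{\sqrt{2\pi}\,\sigma}e^{-z^2/(2\sigma^2)}$ be the density of $V\sim\mathcal N(0,\sigma^2)$. Let $\mathcal M(\mathbb R)$ be the space of finite signed Borel measures on $\mathbb R$ with the total variation norm, and for $\mu\in\mathcal M(\mathbb R)$ let $(f_V*\mu)(y)=\int_{\mathbb R} f_V(y-u)\,d\mu(u)$. Let $\mathcal A_V(\mathbb R)=\{f_V*\mu:\mu\in\mathcal M(\mathbb R)\}$, with the norm $\|f_V*\mu\|_{\mathcal A_V}=\|\mu\|_{TV}$ (the map $\mu\mapsto f_V*\mu$ is injective on $\mathcal M(\mathbb R)$). For $g:\mathbb R\to\mathbb R$ and $y\in\mathbb R$, the Tweedie functional $\mathcal T_{g,V,y}$ is the continuous linear functional on $\mathcal A_V(\mathbb R)$ with $\mathcal T_{g,V,y}[f_V*\mu]=\int_{\mathbb R} g(u)f_V(y-u)\,d\mu(u)$ for all $\mu\in\mathcal M(\mathbb R)$. For $n\ge 1$ and $x\in\mathbb R$ let $$g_{n,x}(u)=\Phi\!\left(\frac{x+n^{-1/2}-u}{n^{-1}}\right),\qquad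 u\in\mathbb R.$$ **(a)** Let $n\ge1$ and $x,y\in\mathbb R$. The Tweedie functional $\mathcal T_{g_{n,x},V,y}$ exists and is unique. Every $f\in\mathcal A_V(\mathbb R)$ is infinitely differentiable, and $$\mathcal T_{g_{n,x},V,y}[f]=\sum_{k=0}^\infty \frac{(-1)^k}{k!}\left(\frac{\sigma^2}{\sqrt{\sigma^2+n^{-2}}}\right)^k\Phi^{(k)}\!\left(\frac{x+n^{-1/2}-y}{\sqrt{\sigma^2+n^{-2}}}\right)f^{(k)}(y),$$ where the series converges absolutely. **(b)** Let $X$ and $V$ be independent real random variables on a probability space, with $V\sim\mathcal N(0,\sigma^2)$ and $X$ of arbitrary law $P_X$, and let $Y=X+V$. Then $f_Y=f_V*P_X$ is a density of $Y$ and is positive everywhere. The function $$\mathbb P[X\le x\mid Y=y]:=\frac{1}{f_Y(y)}\int_{(-\infty,x]}f_V(y-u)\,dP_X(u)$$ is a version of the posterior distribution function: for $P_Y$-almost every $y$ it agrees, for all $x$, with the distribution function of the regular conditional law of $X$ given $Y=y$. For all $x,y\in\mathbb R$, $$\mathbb P[X\le x\mid Y=y]=\frac1{f_Y(y)}\lim_{n\to\infty}\sum_{k=0}^\infty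 \frac{(-1)^k}{k!}\left(\frac{\sigma^2}{\sqrt{\sigma^2+n^{-2}}}\right)^k\Phi^{(k)}\!\left(\frac{x+n^{-1/2}-y}{\sqrt{\sigma^2+n^{-2}}}\right)f_Y^{(k)}(y)$$ $$=\Phi\!\left(\frac{x-y}{\sigma}\right)+\frac1{f_Y(y)}\lim_{n\to\infty}\sum_{k=1}^\infty \frac{(-1)^k}{k!}\left(\frac{\sigma^2}{\sqrt{\sigma^2+n^{-2}}}\right)^k\Phi^{(k)}\!\left(\frac{x+n^{-1/2}-y}{\sqrt{\sigma^2+n^{-2}}}\right)f_Y^{(k)}(y),$$ where both limits exist. -/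

import Mathlib

open MeasureTheory ProbabilityTheory Filter Topology
open scoped ContDiff

noncomputable section

namespace Tweedie

/-- The Lebesgue density `f_V` of the noise `V ~ N(0, σ²)`. -/
def noiseDensity (σ : ℝ) : ℝ → ℝ := gaussianPDFReal 0 (σ ^ 2).toNNReal

theorem measurable_noiseDensity (σ : ℝ) : Measurable (noiseDensity σ) :=
  measurable_gaussianPDFReal _ _

theorem abs_noiseDensity_le (σ : ℝ) :
    ∃ C : ℝ, ∀ z, ‖noiseDensity σ z‖ ≤ C := by
  refine ⟨(√(2 * Real.pi * (σ ^ 2).toNNReal))⁻¹, fun z => ?_⟩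
  rw [noiseDensity, Real.norm_of_nonneg (gaussianPDFReal_nonneg _ _ _), gaussianPDFReal]
  refine mul_le_of_le_one_right (by positivity) ?_
  rw [Real.exp_le_one_iff, neg_div]
  exact neg_nonpos.2 (by positivity)

theorem integrable_noiseDensity_sub (σ y : ℝ) (μ : SignedMeasure ℝ) :
    μ.Integrable fun x => noiseDensity σ (y - x) := by
  obtain ⟨C, hC⟩ := abs_noiseDensity_le σ
  have : IsFiniteMeasure μ.variation := by
    rw [← SignedMeasure.totalVariation_eq_variation]
    unfold SignedMeasure.totalVariation
    infer_instance
  exact Integrable.of_bound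
    ((measurable_noiseDensity σ).comp (measurable_const.sub measurable_id)).aestronglyMeasurable
    C (ae_of_all _ fun x => hC _)

/-- The convolution operator `K_V[μ](y) = ∫ f_V(y - x) dμ(x)` on finite signed measures
(a `SignedMeasure ℝ` is automatically finite, and Radon). -/
def convNoise (σ : ℝ) : SignedMeasure ℝ →ₗ[ℝ] (ℝ → ℝ) where
  toFun μ y := ∫ᵛ x, noiseDensity σ (y - x) ∂<•μ
  map_add' μ ν := by
    funext y
    exact VectorMeasure.integral_add_vectorMeasure
      (integrable_noiseDensity_sub σ y μ) (integrable_noiseDensity_sub σ y ν)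
  map_smul' c μ := by
    funext y
    exact VectorMeasure.integral_smul_vectorMeasure _ c

/-- The class `A_V(ℝ)` of `V`-admissible mixtures: the range of `K_V`. -/
def admissible (σ : ℝ) : Submodule ℝ (ℝ → ℝ) := LinearMap.range (convNoise σ)

/-- `K_V[μ]` as an element of `A_V(ℝ)`. -/
def mixture (σ : ℝ) (μ : SignedMeasure ℝ) : admissible σ := ⟨convNoise σ μ, μ, rfl⟩

/-- The inverse `K_V⁻¹ : A_V(ℝ) → M(ℝ)`. -/
def mixing {σ : ℝ} (f : admissible σ) : SignedMeasure ℝ := f.2.choose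

/-- The total variation norm, as the norm of the functional that `μ` induces on `C₀(ℝ)`. -/
def tvNorm (μ : SignedMeasure ℝ) : ℝ :=
  sSup {r : ℝ | ∃ h : ZeroAtInftyContinuousMap ℝ ℝ, ‖h‖ ≤ 1 ∧ r = |∫ᵛ x, h x ∂<•μ|}

/-- The norm on `A_V(ℝ)`, transported from the total variation norm by `K_V⁻¹`. -/
def admissibleNorm {σ : ℝ} (f : admissible σ) : ℝ := tvNorm (mixing f)

/-- `T` is the Tweedie functional `T_{g,V,y}`: a linear functional on `A_V(ℝ)` that is continuous
(that is, bounded) for the norm of `A_V(ℝ)` and satisfies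
`T[f_V * μ] = ∫ g(u) f_V(y - u) dμ(u)` for every finite signed measure `μ`. -/
structure IsTweedieFunctional (σ : ℝ) (g : ℝ → ℝ) (y : ℝ) (T : admissible σ →ₗ[ℝ] ℝ) : Prop where
  continuous : ∃ C : ℝ, ∀ f, |T f| ≤ C * admissibleNorm f
  apply_mixture : ∀ μ : SignedMeasure ℝ,
    T (mixture σ μ) = ∫ᵛ u, g u * noiseDensity σ (y - u) ∂<•μ

/-- The standard normal distribution function `Φ`. -/
def Phi (t : ℝ) : ℝ := cdf (gaussianReal 0 1) t

/-- The smoothed indicator `g_{n,x}(u) = Φ((x + n^{-1/2} - u) / n^{-1})`. -/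
def smoothedIndicator (n : ℕ) (x : ℝ) (u : ℝ) : ℝ :=
  Phi ((x + (n : ℝ) ^ (-(1 / 2) : ℝ) - u) / (n : ℝ)⁻¹)

/-- The `k`-th term
`(-1)^k / k! * (σ² / √(σ² + n⁻²))^k * Φ^{(k)}((x + n^{-1/2} - y) / √(σ² + n⁻²)) * f^{(k)}(y)`. -/
def seriesTerm (σ : ℝ) (n : ℕ) (x y : ℝ) (f : ℝ → ℝ) (k : ℕ) : ℝ :=
  (-1) ^ k / (k.factorial : ℝ) * (σ ^ 2 / √(σ ^ 2 + (n : ℝ) ^ (-2 : ℤ))) ^ k *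
    iteratedDeriv k Phi
      ((x + (n : ℝ) ^ (-(1 / 2) : ℝ) - y) / √(σ ^ 2 + (n : ℝ) ^ (-2 : ℤ))) *
    iteratedDeriv k f y

/-- The density `f_Y = K_V[P_X]` of the observation `Y = X + V`. -/
def observedDensity (σ : ℝ) (PX : Measure ℝ) [IsFiniteMeasure PX] : ℝ → ℝ :=
  convNoise σ PX.toSignedMeasure

/-- The posterior distribution function `P[X ≤ x | Y = y]` in its everywhere defined version,
given by Bayes' formula `(∫_{u ≤ x} f_V(y - u) dP_X(u)) / f_Y(y)`. -/
def posteriorCdf (σ : ℝ) (PX : Measure ℝ) [IsFiniteMeasure PX] (x y : ℝ) : ℝ :=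
  (∫ u in Set.Iic x, noiseDensity σ (y - u) ∂PX) / observedDensity σ PX y

end Tweedie

end

/-!
The point is that the Tweedie series can be summed exactly for a single shifted noise density
`f_V(· - u)`, with a bound on its terms that does not depend on `u`; integrating against the mixing
measure then gives the series for every admissible function.

Put `τ = √(σ² + n⁻²)` and `c = σ / τ < 1`. After rescaling, the series of `f_V(· - u)` at `y` is
`∑ (-c)ᵏ / k! Φ⁽ᵏ⁾(s) φ⁽ᵏ⁾(z)` with `φ` the standard normal density, and its `s`-derivative is the
bilinear series `∑ (-c)ᵏ / k! φ⁽ᵏ⁾(s) φ⁽ᵏ⁾(z)`, which Mehler's formula sums (`hasSum_mehler`). To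
prove it, `φ⁽ᵏ⁾(s)` is written as the oscillating Gaussian moment `∫ (iξ)ᵏ e^{iξs} dN(0,1)(ξ)`; the
sum over `k` under the integral is the Taylor series of the entire function `φ` at `z` with complex
increment `-icξ` (`hasSum_taylor_stdNormalPdf`), and a Gaussian Fourier integral remains. Absolute
convergence for every `c < 1` comes from the moment bound `∫ |ξ|ᵏ dN(0,1) ≤ K √(k! / aᵏ)`, valid for
every `a < 1`, whose square divided by `k!` is geometric with ratio `a⁻¹`. The antiderivative in
`s` (`hasSum_mehler_Phi`) is fixed by letting `s → -∞`.

Derivatives pass under the integral against the mixing measure, so the series of `f_V * μ` sums to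
`∫ g_{n,x}(u) f_V(y - u) dμ(u)` (`hasSum_seriesTerm_convNoise`). Hence the series itself defines the
Tweedie functional. It is bounded because its integrand lies in `C₀(ℝ)`, and it is unique because
mixtures exhaust the admissible functions; injectivity of `μ ↦ f_V * μ` is not required for either.

For the posterior, the joint law of `(X + V, X)` has density `f_V(y - u)` with respect to
`dy dP_X(u)`, so Bayes' formula gives a kernel that disintegrates it. Since
`g_{n,x} → 1_{(-∞, x]}` pointwise, dominated convergence yields the limit.
-/

namespace Tweedie

local notation "φ" => gaussianPDFReal 0 1

local notation "γ" => gaussianReal 0 1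

/-! ### Derivatives of the standard normal density and Gaussian moments -/

theorem stdNormalPdf_apply (z : ℝ) : φ z = (√(2 * Real.pi))⁻¹ * Real.exp (-(z ^ 2 / 2)) := by
  simp [gaussianPDFReal, neg_div]

theorem contDiff_stdNormalPdf : ContDiff ℝ ∞ φ := by
  have : φ = fun z => (√(2 * Real.pi))⁻¹ * Real.exp (-(z ^ 2 / 2)) :=
    funext stdNormalPdf_apply
  rw [this]
  fun_prop

theorem hasDerivAt_iteratedDeriv {f : ℝ → ℝ} (hf : ContDiff ℝ ∞ f) (k : ℕ) (x : ℝ) :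
    HasDerivAt (iteratedDeriv k f) (iteratedDeriv (k + 1) f x) x := by
  rw [iteratedDeriv_succ]
  exact (hf.differentiable_iteratedDeriv k (by exact_mod_cast ENat.natCast_lt_top k) x).hasDerivAt

theorem continuous_iteratedDeriv {f : ℝ → ℝ} (hf : ContDiff ℝ ∞ f) (k : ℕ) :
    Continuous (iteratedDeriv k f) :=
  continuous_iff_continuousAt.2 fun x => (hasDerivAt_iteratedDeriv hf k x).continuousAt

theorem iteratedDeriv_ofReal_comp {f : ℝ → ℝ} (hf : ContDiff ℝ ∞ f) (k : ℕ) :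
    iteratedDeriv k (fun x => (f x : ℂ)) = fun x => ((iteratedDeriv k f x : ℝ) : ℂ) := by
  induction k with
  | zero => simp
  | succ k ih =>
    ext x
    rw [iteratedDeriv_succ, ih]
    exact (hasDerivAt_iteratedDeriv hf k x).ofReal_comp.deriv

/-- The standard normal density is, up to normalization, its own characteristic function, so its
derivatives are oscillating Gaussian moments. -/
theorem iteratedDeriv_stdNormalPdf (k : ℕ) (z : ℝ) :
    ((iteratedDeriv k φ z : ℝ) : ℂ) = ((√(2 * Real.pi))⁻¹ : ℝ) *
      (Complex.I ^ k * ∫ ξ : ℝ, (ξ : ℂ) ^ k * Complex.exp (z * ξ * Complex.I) ∂γ) := by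
  have h : (fun x => (φ x : ℂ)) = fun x => (((√(2 * Real.pi))⁻¹ : ℝ) : ℂ) * charFun γ x := by
    ext x
    rw [stdNormalPdf_apply, charFun_gaussianReal]
    push_cast
    congr 2
    simp
  rw [← congrFun (iteratedDeriv_ofReal_comp contDiff_stdNormalPdf k) z, h,
    iteratedDeriv_const_mul_field, iteratedDeriv_charFun]
  exact_mod_cast memLp_id_gaussianReal (k : NNReal)

theorem integrable_exp_mul_sq_gaussianReal {a : ℝ} (ha : a < 1) :
    Integrable (fun ξ : ℝ => Real.exp (a * ξ ^ 2 / 2)) γ := by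
  rw [gaussianReal_of_var_ne_zero _ one_ne_zero,
    integrable_withDensity_iff_integrable_smul₀' (by fun_prop) (by simp [gaussianPDF])]
  refine ((integrable_exp_neg_mul_sq (b := (1 - a) / 2) (by linarith)).const_mul
    (√(2 * Real.pi))⁻¹).congr (ae_of_all _ fun ξ => ?_)
  simp only [toReal_gaussianPDF, stdNormalPdf_apply, smul_eq_mul]
  rw [mul_assoc, ← Real.exp_add]
  congr 2
  ring

/-- Growth rate `√(k! / aᵏ)` of the absolute Gaussian moments. -/
noncomputable def momentRate (a : ℝ) (k : ℕ) : ℝ := √(k.factorial / a ^ k)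

theorem momentRate_pos {a : ℝ} (ha : 0 < a) (k : ℕ) : 0 < momentRate a k := by
  unfold momentRate; positivity

theorem momentRate_mul_self {a : ℝ} (ha : 0 < a) (k : ℕ) :
    momentRate a k * momentRate a k = k.factorial / a ^ k :=
  Real.mul_self_sqrt (by positivity)

theorem momentRate_le_succ {a : ℝ} (ha : 0 < a) (ha1 : a ≤ 1) (k : ℕ) :
    momentRate a k ≤ momentRate a (k + 1) := by
  refine Real.sqrt_le_sqrt ?_
  apply div_le_div₀ (by positivity) _ (by positivity)
  · exact pow_le_pow_of_le_one ha.le ha1 (Nat.le_succ k)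
  · exact_mod_cast Nat.factorial_le (Nat.le_succ k)

/-- Since `Φ` itself is bounded only by `1`, its bound is absorbed into the rates. -/
theorem one_le_momentRate {a : ℝ} (ha : 0 < a) (ha1 : a ≤ 1) (k : ℕ) : 1 ≤ momentRate a k := by
  induction k with
  | zero => simp [momentRate]
  | succ k ih => exact ih.trans (momentRate_le_succ ha ha1 k)

theorem abs_pow_le_momentRate {a : ℝ} (ha : 0 < a) (k : ℕ) (ξ : ℝ) :
    |ξ| ^ k ≤ momentRate a k * Real.exp (a * ξ ^ 2 / 2) := by
  refine le_of_sq_le_sq ?_ (by have := momentRate_pos ha k; positivity)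
  have h := Real.pow_div_factorial_le_exp (a * ξ ^ 2) (by positivity) k
  rw [div_le_iff₀ (by positivity), mul_pow] at h
  rw [mul_pow, sq (momentRate a k), momentRate_mul_self ha, ← Real.exp_nat_mul, ← pow_mul,
    mul_comm k 2, pow_mul, sq_abs, div_mul_eq_mul_div, le_div_iff₀ (by positivity)]
  calc (ξ ^ 2) ^ k * a ^ k = a ^ k * (ξ ^ 2) ^ k := mul_comm _ _
    _ ≤ _ := h
    _ = _ := by rw [mul_comm]; congr 2; push_cast; ring

theorem integrable_abs_pow_gaussianReal (k : ℕ) : Integrable (fun ξ : ℝ => |ξ| ^ k) γ := by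
  refine ((integrable_exp_mul_sq_gaussianReal (a := 1 / 2) (by norm_num)).const_mul
    (momentRate (1 / 2) k)).mono' (by fun_prop) (ae_of_all _ fun ξ => ?_)
  rw [Real.norm_of_nonneg (by positivity)]
  exact abs_pow_le_momentRate (by norm_num) k ξ

theorem integral_abs_pow_gaussianReal_le {a : ℝ} (ha : 0 < a) (ha1 : a < 1) :
    ∃ K : ℝ, 0 ≤ K ∧ ∀ k : ℕ, ∫ ξ : ℝ, |ξ| ^ k ∂γ ≤ K * momentRate a k := by
  refine ⟨∫ ξ : ℝ, Real.exp (a * ξ ^ 2 / 2) ∂γ, integral_nonneg fun _ => by positivity,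
    fun k => ?_⟩
  rw [mul_comm, ← integral_const_mul]
  exact integral_mono (integrable_abs_pow_gaussianReal k)
    ((integrable_exp_mul_sq_gaussianReal ha1).const_mul _) (abs_pow_le_momentRate ha k)

theorem abs_iteratedDeriv_stdNormalPdf_le (k : ℕ) (z : ℝ) :
    |iteratedDeriv k φ z| ≤ ∫ ξ : ℝ, |ξ| ^ k ∂γ := by
  have h : ‖((iteratedDeriv k φ z : ℝ) : ℂ)‖ = |iteratedDeriv k φ z| := Complex.norm_real _
  rw [← h, iteratedDeriv_stdNormalPdf, norm_mul, norm_mul, norm_pow, Complex.norm_I, one_pow,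
    one_mul, Complex.norm_real]
  have h1 : ‖(√(2 * Real.pi))⁻¹‖ ≤ 1 := by
    rw [Real.norm_of_nonneg (by positivity)]
    refine inv_le_one_of_one_le₀ ?_
    rw [Real.one_le_sqrt]
    linarith [Real.pi_gt_three]
  refine (mul_le_of_le_one_left (norm_nonneg _) h1).trans
    ((norm_integral_le_integral_norm _).trans_eq ?_)
  refine integral_congr_ae (ae_of_all _ fun ξ => ?_)
  have := Complex.norm_exp_ofReal_mul_I (z * ξ)
  push_cast at this
  simp [this]

/-- A uniform bound on all derivatives of the standard normal density. The rates of two such bounds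
multiply to `k! / aᵏ` with `a` as close to `1` as desired, which is what convergence of Mehler's
series for every `c < 1` requires. -/
theorem exists_abs_iteratedDeriv_stdNormalPdf_le {a : ℝ} (ha : 0 < a) (ha1 : a < 1) :
    ∃ K : ℝ, 0 ≤ K ∧ ∀ (k : ℕ) (z : ℝ), |iteratedDeriv k φ z| ≤ K * momentRate a k := by
  obtain ⟨K, hK, h⟩ := integral_abs_pow_gaussianReal_le ha ha1
  exact ⟨K, hK, fun k z => (abs_iteratedDeriv_stdNormalPdf_le k z).trans (h k)⟩

theorem pow_div_factorial_mul_momentRate {a : ℝ} (ha : 0 < a) (c : ℝ) (k : ℕ) :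
    c ^ k / k.factorial * momentRate a k * momentRate a k = (c / a) ^ k := by
  rw [mul_assoc, momentRate_mul_self ha, div_pow]
  have : (k.factorial : ℝ) ≠ 0 := by positivity
  field_simp

/-- With a single factor `momentRate a k`, in place of two, the series converges for every `c`; this
makes the Taylor series of the normal density converge for every increment. -/
theorem summable_pow_div_factorial_mul_momentRate {a : ℝ} (ha : 0 < a) (c : ℝ) :
    Summable fun k : ℕ => c ^ k / k.factorial * momentRate a k := by
  refine Summable.of_norm_bounded (g := fun k : ℕ =>
    (2 * c ^ 2 / a) ^ k / k.factorial + (1 / 2 : ℝ) ^ k)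
    ((Real.summable_pow_div_factorial _).add
      (summable_geometric_of_lt_one (by norm_num) (by norm_num))) fun k => ?_
  set x := c ^ k / k.factorial * momentRate a k with hx
  have hsq : (2 * c ^ 2 / a) ^ k / k.factorial = 2 ^ k * x ^ 2 := by
    rw [hx, mul_pow, sq (momentRate a k), momentRate_mul_self ha, div_pow, mul_pow]
    have : (k.factorial : ℝ) ≠ 0 := by positivity
    rw [← pow_mul, mul_comm 2 k, pow_mul]
    field_simp
  -- the arithmetic-geometric inequality `2 |x| ≤ t x² + t⁻¹` with `t = 2ᵏ`
  have ht : (2 : ℝ) ^ k * (1 / 2) ^ k = 1 := by rw [← mul_pow]; norm_num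
  have hp : (0 : ℝ) < (1 / 2) ^ k := by positivity
  rw [hsq, Real.norm_eq_abs]
  have h := mul_nonneg hp.le (sq_nonneg (2 ^ k * |x| - 1))
  have h2 : (1 / 2 : ℝ) ^ k * (2 ^ k * |x| - 1) ^ 2
      = 2 ^ k * x ^ 2 - 2 * |x| + (1 / 2) ^ k := by
    rw [← sq_abs x]
    linear_combination (2 ^ k * |x| ^ 2 - 2 * |x|) * ht
  linarith [abs_nonneg x]

/-! ### Mehler's formula -/

/-- The Taylor series of the standard normal density at `z`, evaluated at a complex increment. -/
theorem hasSum_taylor_stdNormalPdf (z : ℝ) (w : ℂ) :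
    HasSum (fun k : ℕ => w ^ k / k.factorial * ((iteratedDeriv k φ z : ℝ) : ℂ))
      (φ z * Complex.exp (-(z * w) - w ^ 2 / 2)) := by
  obtain ⟨K, hK, hmom⟩ := integral_abs_pow_gaussianReal_le (a := 1 / 2) (by norm_num) (by norm_num)
  set F : ℕ → ℝ → ℂ := fun k ξ =>
    (w * Complex.I) ^ k / k.factorial * ((ξ : ℂ) ^ k * Complex.exp (z * ξ * Complex.I)) with hF
  have hnexp : ∀ ξ : ℝ, ‖Complex.exp (z * ξ * Complex.I)‖ = 1 := fun ξ => by
    have := Complex.norm_exp_ofReal_mul_I (z * ξ)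
    push_cast at this
    exact this
  have hnorm : ∀ k ξ, ‖F k ξ‖ = ‖w‖ ^ k / k.factorial * |ξ| ^ k := fun k ξ => by
    simp [hF, hnexp]
  have hint : ∀ k, Integrable (F k) γ := fun k => by
    refine ((integrable_abs_pow_gaussianReal k).const_mul (‖w‖ ^ k / k.factorial)).mono'
      (by fun_prop) (ae_of_all _ fun ξ => (hnorm k ξ).le)
  have hsum : Summable fun k => ∫ ξ, ‖F k ξ‖ ∂γ := by
    refine Summable.of_nonneg_of_le (fun k => integral_nonneg fun _ => norm_nonneg _) (fun k => ?_)
      ((summable_pow_div_factorial_mul_momentRate (a := 1 / 2) (by norm_num) ‖w‖).mul_left K)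
    simp_rw [hnorm, integral_const_mul]
    calc ‖w‖ ^ k / k.factorial * ∫ ξ, |ξ| ^ k ∂γ
        ≤ ‖w‖ ^ k / k.factorial * (K * momentRate (1 / 2) k) := by gcongr; exact hmom k
      _ = _ := by ring
  have h := (hasSum_integral_of_summable_integral_norm hint hsum).mul_left
    (((√(2 * Real.pi))⁻¹ : ℝ) : ℂ)
  convert! h using 1
  · ext k
    rw [iteratedDeriv_stdNormalPdf]
    simp only [hF]
    rw [integral_const_mul, mul_pow]
    ring
  · have h1 : ∀ ξ : ℝ, ∑' k, F k ξ = Complex.exp ((z + w) * Complex.I * (id ξ : ℝ)) := fun ξ => by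
      have h2 := (NormedSpace.expSeries_div_hasSum_exp (w * Complex.I * ξ)).mul_right
        (Complex.exp (z * ξ * Complex.I))
      rw [← Complex.exp_eq_exp_ℂ, ← Complex.exp_add] at h2
      have h3 : HasSum (fun k => F k ξ) (Complex.exp ((z + w) * Complex.I * (id ξ : ℝ))) := by
        convert! h2 using 1
        · ext k
          simp only [hF, mul_pow]
          ring
        · congr 1
          simp only [id]
          ring
      exact h3.tsum_eq
    have h4 := complexMGF_id_gaussianReal (μ := 0) (v := 1) ((z + w) * Complex.I)
    rw [complexMGF] at h4
    simp_rw [h1, h4, stdNormalPdf_apply]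
    push_cast
    rw [mul_assoc, ← Complex.exp_add]
    congr 2
    rw [mul_pow, Complex.I_sq]
    ring

/-- Against the standard Gaussian weight, `e^{c²ξ²/2}` leaves `e^{-(1 - c²)ξ²/2}`, whose Fourier
transform is again Gaussian. -/
theorem integral_cexp_gaussianReal {c : ℝ} (hc : c ^ 2 < 1) (t : ℝ) :
    ∫ ξ : ℝ, Complex.exp (c ^ 2 * ξ ^ 2 / 2 + t * ξ * Complex.I) ∂γ =
      ((√(1 - c ^ 2))⁻¹ * Real.exp (-((t / √(1 - c ^ 2)) ^ 2 / 2)) : ℝ) := by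
  have hd : 0 < 1 - c ^ 2 := by linarith
  rw [integral_gaussianReal_eq_integral_smul one_ne_zero]
  have h1 : ∀ ξ : ℝ, φ ξ • Complex.exp (c ^ 2 * ξ ^ 2 / 2 + t * ξ * Complex.I) =
      ((√(2 * Real.pi))⁻¹ : ℝ) *
        Complex.exp ((-(1 - c ^ 2) / 2 : ℝ) * ξ ^ 2 + (t * Complex.I) * ξ + 0) := fun ξ => by
    rw [stdNormalPdf_apply, Complex.real_smul]
    push_cast
    rw [mul_assoc, ← Complex.exp_add]
    congr 2
    ring
  simp_rw [h1]
  rw [integral_const_mul, integral_cexp_quadratic (by rw [Complex.ofReal_re]; linarith)]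
  have h2 : ((Real.pi : ℂ) / -((-(1 - c ^ 2) / 2 : ℝ) : ℂ)) ^ (1 / 2 : ℂ) =
      (√(2 * Real.pi) / √(1 - c ^ 2) : ℝ) := by
    rw [← Real.sqrt_div (by positivity), Real.sqrt_eq_rpow, Complex.ofReal_cpow (by positivity)]
    push_cast
    congr 1
    have : (1 : ℂ) - c ^ 2 ≠ 0 := by exact_mod_cast hd.ne'
    field_simp
  have h3 : (0 : ℂ) - (t * Complex.I) ^ 2 / (4 * ((-(1 - c ^ 2) / 2 : ℝ) : ℂ)) =
      (-((t / √(1 - c ^ 2)) ^ 2 / 2) : ℝ) := by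
    rw [div_pow, Real.sq_sqrt hd.le, mul_pow, Complex.I_sq]
    push_cast
    have : (1 : ℂ) - c ^ 2 ≠ 0 := by exact_mod_cast hd.ne'
    field_simp
    ring
  rw [h2, h3, ← Complex.ofReal_exp, ← mul_assoc, ← Complex.ofReal_mul, ← Complex.ofReal_mul]
  congr 2
  have : √(2 * Real.pi) ≠ 0 := by positivity
  field_simp

/-- **Mehler's formula** for the derivatives of the standard normal density. -/
theorem hasSum_mehler {c : ℝ} (hc0 : 0 ≤ c) (hc : c < 1) (s z : ℝ) :
    HasSum (fun k : ℕ => (-c) ^ k / k.factorial * iteratedDeriv k φ s * iteratedDeriv k φ z)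
      (φ z * ((√(1 - c ^ 2))⁻¹ * φ ((s + c * z) / √(1 - c ^ 2)))) := by
  obtain ⟨a, hca, ha1⟩ := exists_between hc
  have ha : 0 < a := hc0.trans_lt hca
  obtain ⟨K, hK, hmom⟩ := integral_abs_pow_gaussianReal_le ha ha1
  set F : ℕ → ℝ → ℂ := fun k ξ => (-c * (Complex.I * ξ)) ^ k / k.factorial *
    ((iteratedDeriv k φ z : ℝ) : ℂ) * Complex.exp (s * ξ * Complex.I) with hF
  have hnexp : ∀ ξ : ℝ, ‖Complex.exp (s * ξ * Complex.I)‖ = 1 := fun ξ => by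
    have := Complex.norm_exp_ofReal_mul_I (s * ξ)
    push_cast at this
    exact this
  have hnorm : ∀ k ξ, ‖F k ξ‖ = c ^ k / k.factorial * |iteratedDeriv k φ z| * |ξ| ^ k :=
    fun k ξ => by
      simp only [hF, norm_mul, norm_div, norm_pow, norm_neg, Complex.norm_I, Complex.norm_real,
        hnexp, Real.norm_eq_abs, abs_of_nonneg hc0, Complex.norm_natCast]
      ring
  have hint : ∀ k, Integrable (F k) γ := fun k => by
    refine ((integrable_abs_pow_gaussianReal k).const_mul
      (c ^ k / k.factorial * |iteratedDeriv k φ z|)).mono'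
      (by fun_prop) (ae_of_all _ fun ξ => (hnorm k ξ).le)
  have hsum : Summable fun k => ∫ ξ, ‖F k ξ‖ ∂γ := by
    refine Summable.of_nonneg_of_le (fun k => integral_nonneg fun _ => norm_nonneg _) (fun k => ?_)
      ((summable_geometric_of_lt_one (r := c / a) (by positivity)
        ((div_lt_one ha).2 hca)).mul_left (K * K))
    simp_rw [hnorm, integral_const_mul]
    have hm := (momentRate_pos ha k).le
    calc c ^ k / k.factorial * |iteratedDeriv k φ z| * ∫ ξ, |ξ| ^ k ∂γ
        ≤ c ^ k / k.factorial * (K * momentRate a k) * (K * momentRate a k) := by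
          have h := (abs_iteratedDeriv_stdNormalPdf_le k z).trans (hmom k)
          gcongr
          exact hmom k
      _ = K * K * (c ^ k / k.factorial * momentRate a k * momentRate a k) := by ring
      _ = _ := by rw [pow_div_factorial_mul_momentRate ha]
  have h := (hasSum_integral_of_summable_integral_norm hint hsum).mul_left
    (((√(2 * Real.pi))⁻¹ : ℝ) : ℂ)
  rw [← Complex.hasSum_ofReal]
  convert! h using 1
  · ext k
    push_cast
    rw [iteratedDeriv_stdNormalPdf k s]
    simp only [hF]
    rw [← integral_const_mul, ← integral_const_mul, ← integral_const_mul, ← integral_mul_const,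
      ← integral_const_mul]
    refine integral_congr_ae (ae_of_all _ fun ξ => ?_)
    simp only [mul_pow]
    push_cast
    ring
  · have h1 : ∀ ξ : ℝ, ∑' k, F k ξ =
        φ z * Complex.exp (c ^ 2 * ξ ^ 2 / 2 + (s + c * z : ℝ) * ξ * Complex.I) := fun ξ => by
      rw [((hasSum_taylor_stdNormalPdf z (-c * (Complex.I * ξ))).mul_right
        (Complex.exp (s * ξ * Complex.I))).tsum_eq, mul_assoc, ← Complex.exp_add]
      congr 2
      rw [mul_pow, mul_pow, Complex.I_sq]
      push_cast
      ring
    simp_rw [h1]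
    rw [integral_const_mul, integral_cexp_gaussianReal (by nlinarith),
      stdNormalPdf_apply ((s + c * z) / _)]
    push_cast
    ring

/-! ### Mehler's formula with the normal distribution function -/

theorem hasDerivAt_Phi (t : ℝ) : HasDerivAt Phi (φ t) t := by
  have hint : Integrable φ := integrable_gaussianPDFReal 0 1
  have hcont : Continuous φ := contDiff_stdNormalPdf.continuous
  have h1 : Phi = fun x => ∫ u in Set.Iic x, φ u := by
    ext x
    rw [Phi, cdf_eq_real, measureReal_def, gaussianReal_apply_eq_integral _ one_ne_zero,
      ENNReal.toReal_ofReal (integral_nonneg fun _ => gaussianPDFReal_nonneg _ _ _)]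
  have h2 : ∀ x, Phi x = (∫ u in Set.Iic 0, φ u) + ∫ u in (0 : ℝ)..x, φ u := fun x => by
    rw [h1, ← intervalIntegral.integral_Iic_sub_Iic hint.integrableOn hint.integrableOn]
    ring
  rw [funext h2]
  exact (intervalIntegral.integral_hasDerivAt_right (hcont.intervalIntegrable _ _)
    (hcont.stronglyMeasurableAtFilter _ _) hcont.continuousAt).const_add _

theorem continuous_Phi : Continuous Phi :=
  continuous_iff_continuousAt.2 fun t => (hasDerivAt_Phi t).continuousAt

theorem Phi_nonneg (t : ℝ) : 0 ≤ Phi t := cdf_nonneg _ _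

theorem Phi_le_one (t : ℝ) : Phi t ≤ 1 := cdf_le_one _ _

theorem iteratedDeriv_succ_Phi (k : ℕ) : iteratedDeriv (k + 1) Phi = iteratedDeriv k φ := by
  rw [iteratedDeriv_succ', funext fun t => (hasDerivAt_Phi t).deriv]

theorem hasDerivAt_iteratedDeriv_Phi (k : ℕ) (t : ℝ) :
    HasDerivAt (iteratedDeriv k Phi) (iteratedDeriv k φ t) t := by
  cases k with
  | zero => simpa using hasDerivAt_Phi t
  | succ k =>
    rw [iteratedDeriv_succ_Phi]
    exact hasDerivAt_iteratedDeriv contDiff_stdNormalPdf k t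

theorem tendsto_polynomial_mul_stdNormalPdf_atBot (p : Polynomial ℝ) :
    Tendsto (fun x => p.eval x * φ x) atBot (𝓝 0) := by
  induction p using Polynomial.induction_on' with
  | add p q hp hq => simpa [add_mul] using hp.add hq
  | monomial n b =>
    have hlim : Tendsto (fun x : ℝ => |b| * momentRate (1 / 2) n * Real.exp (-(x ^ 2 / 4)))
        atBot (𝓝 0) := by
      have h1 : Tendsto (fun x : ℝ => x ^ 2 / 4) atBot atTop := by
        simp_rw [sq]
        exact (tendsto_id.atBot_mul_atBot₀ tendsto_id).atTop_div_const (by norm_num)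
      simpa using (Real.tendsto_exp_neg_atTop_nhds_zero.comp h1).const_mul
        (|b| * momentRate (1 / 2) n)
    refine squeeze_zero_norm (fun x => ?_) hlim
    have h := abs_pow_le_momentRate (a := 1 / 2) (by norm_num) n x
    have h1 : φ x ≤ Real.exp (-(x ^ 2 / 2)) := by
      rw [stdNormalPdf_apply]
      refine mul_le_of_le_one_left (by positivity) (inv_le_one_of_one_le₀ ?_)
      rw [Real.one_le_sqrt]
      linarith [Real.pi_gt_three]
    rw [Polynomial.eval_monomial, norm_mul, norm_mul, norm_pow,
      Real.norm_of_nonneg (gaussianPDFReal_nonneg _ _ _), Real.norm_eq_abs, Real.norm_eq_abs]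
    calc |b| * |x| ^ n * φ x
        ≤ |b| * (momentRate (1 / 2) n * Real.exp (1 / 2 * x ^ 2 / 2)) *
          Real.exp (-(x ^ 2 / 2)) := by
          have := gaussianPDFReal_nonneg 0 1 x
          have := momentRate_pos (a := 1 / 2) (by norm_num) n
          gcongr
      _ = |b| * momentRate (1 / 2) n *
          (Real.exp (1 / 2 * x ^ 2 / 2) * Real.exp (-(x ^ 2 / 2))) := by ring
      _ = _ := by rw [← Real.exp_add]; congr 2; ring

/-- Each derivative of `φ` is a Hermite polynomial times `φ`. -/
theorem tendsto_iteratedDeriv_stdNormalPdf_atBot (k : ℕ) :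
    Tendsto (iteratedDeriv k φ) atBot (𝓝 0) := by
  have h1 : φ = fun z => (√(2 * Real.pi))⁻¹ * Real.exp (-(z ^ 2 / 2)) :=
    funext stdNormalPdf_apply
  have h := tendsto_polynomial_mul_stdNormalPdf_atBot
    (Polynomial.C ((-1) ^ k) * (Polynomial.hermite k).map (Int.castRingHom ℝ))
  refine h.congr fun x => ?_
  conv_rhs => rw [h1, iteratedDeriv_const_mul_field, iteratedDeriv_eq_iterate,
    Polynomial.deriv_gaussian_eq_hermite_mul_gaussian]
  rw [stdNormalPdf_apply, Polynomial.eval_mul, Polynomial.eval_C, Polynomial.eval_map,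
    Polynomial.aeval_def, algebraMap_int_eq]
  ring

theorem tendsto_iteratedDeriv_Phi_atBot (k : ℕ) :
    Tendsto (iteratedDeriv k Phi) atBot (𝓝 0) := by
  cases k with
  | zero =>
    rw [iteratedDeriv_zero]
    exact tendsto_cdf_atBot γ
  | succ k =>
    rw [iteratedDeriv_succ_Phi]
    exact tendsto_iteratedDeriv_stdNormalPdf_atBot k

/-- The terms of the series in Mehler's formula, with or without the antiderivative in the first
variable, have a summable bound that is uniform in both variables. -/
theorem exists_summable_mehler_bound {c : ℝ} (hc0 : 0 ≤ c) (hc : c < 1) :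
    ∃ u : ℕ → ℝ, Summable u ∧
      (∀ k s z, |(-c) ^ k / k.factorial * iteratedDeriv k Phi s * iteratedDeriv k φ z| ≤ u k) ∧
      ∀ k s z, |(-c) ^ k / k.factorial * iteratedDeriv k φ s * iteratedDeriv k φ z| ≤ u k := by
  obtain ⟨a, hca, ha1⟩ := exists_between hc
  have ha : 0 < a := hc0.trans_lt hca
  obtain ⟨K, hK, hb⟩ := exists_abs_iteratedDeriv_stdNormalPdf_le ha ha1
  set M := max K 1 with hM
  have hM0 : 0 ≤ M := hK.trans (le_max_left _ _)
  have hφ : ∀ k z, |iteratedDeriv k φ z| ≤ M * momentRate a k := fun k z =>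
    (hb k z).trans (mul_le_mul_of_nonneg_right (le_max_left _ _) (momentRate_pos ha k).le)
  have hPhi : ∀ k z, |iteratedDeriv k Phi z| ≤ M * momentRate a k := by
    intro k z
    cases k with
    | zero =>
      rw [iteratedDeriv_zero, abs_of_nonneg (Phi_nonneg z)]
      exact (Phi_le_one z).trans
        (one_le_mul_of_one_le_of_one_le (le_max_right _ _) (one_le_momentRate ha ha1.le 0))
    | succ k =>
      rw [iteratedDeriv_succ_Phi]
      exact (hφ k z).trans (mul_le_mul_of_nonneg_left (momentRate_le_succ ha ha1.le k) hM0)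
  have key : ∀ (k : ℕ) (p q : ℝ), |p| ≤ M * momentRate a k → |q| ≤ M * momentRate a k →
      |(-c) ^ k / k.factorial * p * q| ≤ M * M * (c / a) ^ k := by
    intro k p q hp hq
    have hm := (momentRate_pos ha k).le
    rw [abs_mul, abs_mul, abs_div, abs_pow, abs_neg, abs_of_nonneg hc0, Nat.abs_cast]
    calc c ^ k / k.factorial * |p| * |q|
        ≤ c ^ k / k.factorial * (M * momentRate a k) * (M * momentRate a k) := by gcongr
      _ = M * M * (c ^ k / k.factorial * momentRate a k * momentRate a k) := by ring
      _ = _ := by rw [pow_div_factorial_mul_momentRate ha]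
  exact ⟨fun k => M * M * (c / a) ^ k,
    (summable_geometric_of_lt_one (by positivity) ((div_lt_one ha).2 hca)).mul_left _,
    fun k s z => key k _ _ (hPhi k s) (hφ k z), fun k s z => key k _ _ (hφ k s) (hφ k z)⟩

/-- The antiderivative of Mehler's formula in its first variable. Both sides have the same
derivative in `s` and tend to `0` as `s → -∞`. -/
theorem hasSum_mehler_Phi {c : ℝ} (hc0 : 0 ≤ c) (hc : c < 1) (s z : ℝ) :
    HasSum (fun k : ℕ => (-c) ^ k / k.factorial * iteratedDeriv k Phi s * iteratedDeriv k φ z)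
      (φ z * Phi ((s + c * z) / √(1 - c ^ 2))) := by
  obtain ⟨u, hu, hu1, hu2⟩ := exists_summable_mehler_bound hc0 hc
  have hd : 0 < √(1 - c ^ 2) := Real.sqrt_pos.2 (by nlinarith)
  set G : ℝ → ℝ := fun s =>
    ∑' k : ℕ, (-c) ^ k / k.factorial * iteratedDeriv k Phi s * iteratedDeriv k φ z with hG
  have hsum : ∀ s, Summable fun k : ℕ =>
      (-c) ^ k / k.factorial * iteratedDeriv k Phi s * iteratedDeriv k φ z := fun s =>
    hu.of_norm_bounded fun k => hu1 k s z
  have hG' : ∀ s, HasDerivAt G (φ z * ((√(1 - c ^ 2))⁻¹ * φ ((s + c * z) / √(1 - c ^ 2)))) s := by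
    intro s
    rw [← (hasSum_mehler hc0 hc s z).tsum_eq]
    exact hasDerivAt_tsum hu
      (fun k t => ((hasDerivAt_iteratedDeriv_Phi k t).const_mul _).mul_const _)
      (fun k t => hu2 k t z) (hsum 0) s
  have hR : ∀ s, HasDerivAt (fun s => φ z * Phi ((s + c * z) / √(1 - c ^ 2)))
      (φ z * ((√(1 - c ^ 2))⁻¹ * φ ((s + c * z) / √(1 - c ^ 2)))) s := by
    intro s
    have h1 : HasDerivAt (fun s : ℝ => (s + c * z) / √(1 - c ^ 2)) (1 / √(1 - c ^ 2)) s :=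
      ((hasDerivAt_id s).add_const _).div_const _
    have h2 := ((hasDerivAt_Phi _).comp s h1).const_mul (φ z)
    rwa [one_div, mul_comm (φ ((s + c * z) / _))] at h2
  have hGlim : Tendsto G atBot (𝓝 0) := by
    have h := tendsto_tsum_of_dominated_convergence (𝓕 := atBot)
      (f := fun s (k : ℕ) => (-c) ^ k / k.factorial * iteratedDeriv k Phi s * iteratedDeriv k φ z)
      (g := fun _ => 0) hu (fun k => by
        simpa using ((tendsto_iteratedDeriv_Phi_atBot k).const_mul _).mul_const _)
      (Eventually.of_forall fun s k => hu1 k s z)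
    simpa using h
  have hRlim : Tendsto (fun s => φ z * Phi ((s + c * z) / √(1 - c ^ 2))) atBot (𝓝 0) := by
    have h1 : Tendsto (fun s : ℝ => (s + c * z) / √(1 - c ^ 2)) atBot atBot :=
      (tendsto_atBot_add_const_right _ _ tendsto_id).atBot_div_const hd
    have h2 : Tendsto Phi atBot (𝓝 0) := tendsto_cdf_atBot γ
    simpa using (h2.comp h1).const_mul (φ z)
  have hconst := is_const_of_deriv_eq_zero
    (f := fun s => G s - φ z * Phi ((s + c * z) / √(1 - c ^ 2)))
    (fun s => ((hG' s).sub (hR s)).differentiableAt)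
    (fun s => (((hG' s).sub (hR s)).congr_deriv (sub_self _)).deriv)
  have hzero : G s - φ z * Phi ((s + c * z) / √(1 - c ^ 2)) = 0 := by
    have h := hGlim.sub hRlim
    rw [funext fun t => hconst t s, sub_zero] at h
    exact tendsto_nhds_unique tendsto_const_nhds h
  rw [← sub_eq_zero.1 hzero]
  exact (hsum s).hasSum

/-! ### The Gaussian noise density -/

theorem noiseDensity_eq {σ : ℝ} (hσ : 0 < σ) :
    noiseDensity σ = fun z => σ⁻¹ * φ (σ⁻¹ * z) := by
  ext z
  rw [noiseDensity, stdNormalPdf_apply, gaussianPDFReal, Real.coe_toNNReal _ (sq_nonneg σ),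
    Real.sqrt_mul (by positivity), Real.sqrt_sq hσ.le, mul_inv, sub_zero, mul_pow, inv_pow,
    mul_comm _ σ⁻¹, mul_assoc]
  congr 3
  field_simp

theorem contDiff_noiseDensity {σ : ℝ} (hσ : 0 < σ) : ContDiff ℝ ∞ (noiseDensity σ) := by
  rw [noiseDensity_eq hσ]
  exact contDiff_const.mul (contDiff_stdNormalPdf.comp (contDiff_const.mul contDiff_id))

theorem iteratedDeriv_noiseDensity {σ : ℝ} (hσ : 0 < σ) (k : ℕ) (z : ℝ) :
    iteratedDeriv k (noiseDensity σ) z = σ⁻¹ * ((σ⁻¹) ^ k * iteratedDeriv k φ (σ⁻¹ * z)) := by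
  rw [noiseDensity_eq hσ, iteratedDeriv_const_mul_field,
    iteratedDeriv_comp_const_mul (contDiff_stdNormalPdf.of_le (by exact_mod_cast le_top))]

theorem exists_abs_iteratedDeriv_noiseDensity_le {σ : ℝ} (hσ : 0 < σ) (k : ℕ) :
    ∃ C : ℝ, ∀ z, |iteratedDeriv k (noiseDensity σ) z| ≤ C := by
  refine ⟨σ⁻¹ * ((σ⁻¹) ^ k * ∫ ξ : ℝ, |ξ| ^ k ∂γ), fun z => ?_⟩
  rw [iteratedDeriv_noiseDensity hσ, abs_mul, abs_mul, abs_of_pos (by positivity : 0 < σ⁻¹),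
    abs_of_pos (by positivity : 0 < σ⁻¹ ^ k)]
  gcongr
  exact abs_iteratedDeriv_stdNormalPdf_le k _

theorem smoothing_ratio {σ : ℝ} (hσ : 0 < σ) {n : ℕ} (hn : 1 ≤ n) :
    0 ≤ σ / √(σ ^ 2 + (n : ℝ) ^ (-2 : ℤ)) ∧ σ / √(σ ^ 2 + (n : ℝ) ^ (-2 : ℤ)) < 1 := by
  have hn' : (0 : ℝ) < n := by exact_mod_cast hn
  refine ⟨by positivity, (div_lt_one (by positivity)).2 (Real.lt_sqrt_of_sq_lt ?_)⟩
  have : (0 : ℝ) < (n : ℝ) ^ (-2 : ℤ) := by positivity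
  linarith

/-- The factor of `f^{(k)}(y)` in the `k`-th term of the Tweedie series. -/
noncomputable def seriesCoeff (σ : ℝ) (n : ℕ) (x y : ℝ) (k : ℕ) : ℝ :=
  (-1) ^ k / (k.factorial : ℝ) * (σ ^ 2 / √(σ ^ 2 + (n : ℝ) ^ (-2 : ℤ))) ^ k *
    iteratedDeriv k Phi
      ((x + (n : ℝ) ^ (-(1 / 2) : ℝ) - y) / √(σ ^ 2 + (n : ℝ) ^ (-2 : ℤ)))

theorem seriesTerm_eq (σ : ℝ) (n : ℕ) (x y : ℝ) (f : ℝ → ℝ) (k : ℕ) :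
    seriesTerm σ n x y f k = seriesCoeff σ n x y k * iteratedDeriv k f y := rfl

theorem seriesCoeff_mul_iteratedDeriv_noiseDensity {σ : ℝ} (hσ : 0 < σ) (n : ℕ) (x y u : ℝ)
    (k : ℕ) :
    seriesCoeff σ n x y k * iteratedDeriv k (noiseDensity σ) (y - u) =
    σ⁻¹ * ((-(σ / √(σ ^ 2 + (n : ℝ) ^ (-2 : ℤ)))) ^ k / k.factorial *
      iteratedDeriv k Phi
        ((x + (n : ℝ) ^ (-(1 / 2) : ℝ) - y) / √(σ ^ 2 + (n : ℝ) ^ (-2 : ℤ))) *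
      iteratedDeriv k φ (σ⁻¹ * (y - u))) := by
  set τ := √(σ ^ 2 + (n : ℝ) ^ (-2 : ℤ))
  have h : (-(σ / τ)) ^ k = (-1) ^ k * (σ ^ 2 / τ) ^ k * (σ⁻¹) ^ k := by
    rw [← mul_pow, ← mul_pow]
    congr 1
    field_simp
  rw [seriesCoeff, iteratedDeriv_noiseDensity hσ, h]
  ring

/-- The Tweedie series of a single shifted noise density, that is, of the mixture `f_V * δ_u`. -/
theorem hasSum_series_noiseDensity {σ : ℝ} (hσ : 0 < σ) {n : ℕ} (hn : 1 ≤ n) (x y u : ℝ) :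
    HasSum (fun k : ℕ =>
      seriesCoeff σ n x y k * iteratedDeriv k (noiseDensity σ) (y - u))
      (smoothedIndicator n x u * noiseDensity σ (y - u)) := by
  simp_rw [seriesCoeff_mul_iteratedDeriv_noiseDensity hσ]
  obtain ⟨h0, h1⟩ := smoothing_ratio hσ hn
  have h := (hasSum_mehler_Phi h0 h1
    ((x + (n : ℝ) ^ (-(1 / 2) : ℝ) - y) / √(σ ^ 2 + (n : ℝ) ^ (-2 : ℤ)))
    (σ⁻¹ * (y - u))).mul_left σ⁻¹
  convert! h using 1
  have hn' : (0 : ℝ) < n := by exact_mod_cast hn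
  have hτ : 0 < σ ^ 2 + (n : ℝ) ^ (-2 : ℤ) := by positivity
  -- with `τ² = σ² + n⁻²` one has `√(1 - (σ / τ)²) = n⁻¹ / τ`
  have hsqrt : √(1 - (σ / √(σ ^ 2 + (n : ℝ) ^ (-2 : ℤ))) ^ 2) =
      (n : ℝ)⁻¹ / √(σ ^ 2 + (n : ℝ) ^ (-2 : ℤ)) := by
    rw [← Real.sqrt_sq (by positivity : 0 ≤ (n : ℝ)⁻¹ / √(σ ^ 2 + (n : ℝ) ^ (-2 : ℤ)))]
    congr 1
    rw [div_pow, div_pow, Real.sq_sqrt hτ.le, eq_div_iff hτ.ne', sub_mul, div_mul_cancel₀ _ hτ.ne']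
    simp [zpow_neg]
  rw [hsqrt, noiseDensity_eq hσ, smoothedIndicator]
  have harg : ((x + (n : ℝ) ^ (-(1 / 2) : ℝ) - y) / √(σ ^ 2 + (n : ℝ) ^ (-2 : ℤ)) +
      σ / √(σ ^ 2 + (n : ℝ) ^ (-2 : ℤ)) * (σ⁻¹ * (y - u))) /
        ((n : ℝ)⁻¹ / √(σ ^ 2 + (n : ℝ) ^ (-2 : ℤ))) =
      (x + (n : ℝ) ^ (-(1 / 2) : ℝ) - u) / (n : ℝ)⁻¹ := by
    have := (Real.sqrt_pos.2 hτ).ne'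
    generalize (n : ℝ) ^ (-(1 / 2) : ℝ) = b
    generalize √(σ ^ 2 + (n : ℝ) ^ (-2 : ℤ)) = τ at *
    field_simp
    ring
  rw [harg]
  ring

theorem exists_summable_series_bound {σ : ℝ} (hσ : 0 < σ) {n : ℕ} (hn : 1 ≤ n) (x y : ℝ) :
    ∃ u : ℕ → ℝ, Summable u ∧ ∀ k w,
      |seriesCoeff σ n x y k * iteratedDeriv k (noiseDensity σ) (y - w)| ≤ u k := by
  obtain ⟨h0, h1⟩ := smoothing_ratio hσ hn
  obtain ⟨u, hu, hu1, -⟩ := exists_summable_mehler_bound h0 h1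
  refine ⟨fun k => σ⁻¹ * u k, hu.mul_left _, fun k w => ?_⟩
  rw [seriesCoeff_mul_iteratedDeriv_noiseDensity hσ, abs_mul, abs_of_pos (by positivity : 0 < σ⁻¹)]
  exact mul_le_mul_of_nonneg_left (hu1 k _ _) (by positivity)

/-! ### Noise mixtures of signed measures -/

theorem isFiniteMeasure_variation (μ : SignedMeasure ℝ) : IsFiniteMeasure μ.variation := by
  rw [← SignedMeasure.totalVariation_eq_variation, SignedMeasure.totalVariation]
  infer_instance

theorem integrable_variation_of_bounded (μ : SignedMeasure ℝ) {h : ℝ → ℝ} (hm : Measurable h)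
    {C : ℝ} (hC : ∀ u, |h u| ≤ C) : μ.Integrable h :=
  have := isFiniteMeasure_variation μ
  Integrable.of_bound hm.aestronglyMeasurable C (ae_of_all _ hC)

theorem integral_signedMeasure_eq_sub (μ : SignedMeasure ℝ) {h : ℝ → ℝ} (hm : Measurable h)
    {C : ℝ} (hC : ∀ u, |h u| ≤ C) :
    ∫ᵛ u, h u ∂<•μ = (∫ u, h u ∂μ.toJordanDecomposition.posPart) -
      ∫ u, h u ∂μ.toJordanDecomposition.negPart := by
  conv_lhs => rw [← μ.toSignedMeasure_toJordanDecomposition, JordanDecomposition.toSignedMeasure]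
  rw [VectorMeasure.integral_sub_vectorMeasure (integrable_variation_of_bounded _ hm hC)
    (integrable_variation_of_bounded _ hm hC), VectorMeasure.integral_toSignedMeasure,
    VectorMeasure.integral_toSignedMeasure]

theorem hasDerivAt_integral_sub (ν : Measure ℝ) [IsFiniteMeasure ν] {g g' : ℝ → ℝ}
    (hg : ∀ z, HasDerivAt g (g' z) z) (hgm : Measurable g) (hgm' : Measurable g') {C C' : ℝ}
    (hC : ∀ z, |g z| ≤ C) (hC' : ∀ z, |g' z| ≤ C') (y : ℝ) :
    HasDerivAt (fun y => ∫ u, g (y - u) ∂ν) (∫ u, g' (y - u) ∂ν) y :=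
  (hasDerivAt_integral_of_dominated_loc_of_deriv_le (F := fun y u => g (y - u))
    (F' := fun y u => g' (y - u)) (bound := fun _ => C') (s := Set.univ) univ_mem
    (Eventually.of_forall fun _ => (by fun_prop : Measurable _).aestronglyMeasurable)
    (Integrable.of_bound (by fun_prop : Measurable _).aestronglyMeasurable C
      (ae_of_all _ fun _ => hC _))
    (by fun_prop : Measurable _).aestronglyMeasurable (ae_of_all _ fun _ _ _ => hC' _)
    (integrable_const _)
    (ae_of_all _ fun u z _ => (hg (z - u)).comp_sub_const z u)).2

theorem hasDerivAt_integral_iteratedDeriv_noiseDensity {σ : ℝ} (hσ : 0 < σ)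
    (μ : SignedMeasure ℝ) (k : ℕ) (y : ℝ) :
    HasDerivAt (fun y => ∫ᵛ u, iteratedDeriv k (noiseDensity σ) (y - u) ∂<•μ)
      (∫ᵛ u, iteratedDeriv (k + 1) (noiseDensity σ) (y - u) ∂<•μ) y := by
  have hm : ∀ k, Measurable (iteratedDeriv k (noiseDensity σ)) := fun k =>
    (continuous_iteratedDeriv (contDiff_noiseDensity hσ) k).measurable
  choose C hC using exists_abs_iteratedDeriv_noiseDensity_le hσ
  have hJ : ∀ k y, ∫ᵛ u, iteratedDeriv k (noiseDensity σ) (y - u) ∂<•μ =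
      (∫ u, iteratedDeriv k (noiseDensity σ) (y - u) ∂μ.toJordanDecomposition.posPart) -
        ∫ u, iteratedDeriv k (noiseDensity σ) (y - u) ∂μ.toJordanDecomposition.negPart :=
    fun k y => integral_signedMeasure_eq_sub μ
      ((hm k).comp (measurable_const.sub measurable_id)) fun _ => hC k _
  simp_rw [hJ]
  have h := fun (ν : Measure ℝ) [IsFiniteMeasure ν] => hasDerivAt_integral_sub ν
    (hasDerivAt_iteratedDeriv (contDiff_noiseDensity hσ) k) (hm k) (hm (k + 1)) (hC k)
    (hC (k + 1)) y
  exact (h _).sub (h _)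

theorem iteratedDeriv_convNoise {σ : ℝ} (hσ : 0 < σ) (μ : SignedMeasure ℝ) (k : ℕ) :
    iteratedDeriv k (convNoise σ μ) =
      fun y => ∫ᵛ u, iteratedDeriv k (noiseDensity σ) (y - u) ∂<•μ := by
  induction k with
  | zero => simp [convNoise]
  | succ k ih =>
    rw [iteratedDeriv_succ, ih]
    exact funext fun y => (hasDerivAt_integral_iteratedDeriv_noiseDensity hσ μ k y).deriv

theorem contDiff_convNoise {σ : ℝ} (hσ : 0 < σ) (μ : SignedMeasure ℝ) :
    ContDiff ℝ ∞ (convNoise σ μ) := by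
  refine contDiff_of_differentiable_iteratedDeriv fun k _ y => ?_
  rw [iteratedDeriv_convNoise hσ]
  exact (hasDerivAt_integral_iteratedDeriv_noiseDensity hσ μ k y).differentiableAt

/-! ### The Tweedie series and the Tweedie functional -/

theorem continuous_smoothedIndicator (n : ℕ) (x : ℝ) : Continuous (smoothedIndicator n x) :=
  continuous_Phi.comp ((continuous_const.sub continuous_id).div_const _)

theorem abs_smoothedIndicator_le_one (n : ℕ) (x u : ℝ) : |smoothedIndicator n x u| ≤ 1 := by
  rw [smoothedIndicator, abs_of_nonneg (Phi_nonneg _)]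
  exact Phi_le_one _

/-- The Tweedie series of a mixture, obtained by integrating the series of the shifted noise
densities against the mixing measure. -/
theorem hasSum_seriesTerm_convNoise {σ : ℝ} (hσ : 0 < σ) {n : ℕ} (hn : 1 ≤ n) (x y : ℝ)
    (μ : SignedMeasure ℝ) :
    HasSum (seriesTerm σ n x y (convNoise σ μ))
      (∫ᵛ u, smoothedIndicator n x u * noiseDensity σ (y - u) ∂<•μ) := by
  have := isFiniteMeasure_variation μ
  obtain ⟨b, hb, hbound⟩ := exists_summable_series_bound hσ hn x y
  have h : HasSum
      (fun k => ∫ᵛ u, seriesCoeff σ n x y k * iteratedDeriv k (noiseDensity σ) (y - u) ∂<•μ)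
      (∫ᵛ u, smoothedIndicator n x u * noiseDensity σ (y - u) ∂<•μ) :=
    VectorMeasure.hasSum_integral_of_dominated_convergence (fun k _ => b k)
    (fun k => (continuous_const.mul ((continuous_iteratedDeriv (contDiff_noiseDensity hσ) k).comp
      (continuous_const.sub continuous_id))).aestronglyMeasurable)
    (fun k => ae_of_all _ fun u => hbound k u) (ae_of_all _ fun _ => hb) (integrable_const _)
    (ae_of_all _ fun u => hasSum_series_noiseDensity hσ hn x y u)
  convert! h using 1
  ext k
  rw [seriesTerm_eq, iteratedDeriv_convNoise hσ]
  exact (VectorMeasure.integral_smul _ _ _ (seriesCoeff σ n x y k)).symm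

/-- The integral of a `C₀` function is controlled by the total variation norm. The constant
`‖h‖ + 1`, rather than `‖h‖`, allows `h` to be normalized even if it vanishes. -/
theorem abs_integral_le_mul_tvNorm (μ : SignedMeasure ℝ) (h : ZeroAtInftyContinuousMap ℝ ℝ) :
    |∫ᵛ u, h u ∂<•μ| ≤ (‖h‖ + 1) * tvNorm μ := by
  have := isFiniteMeasure_variation μ
  have hbdd : BddAbove {r : ℝ | ∃ g : ZeroAtInftyContinuousMap ℝ ℝ, ‖g‖ ≤ 1 ∧
      r = |∫ᵛ x, g x ∂<•μ|} := by
    refine ⟨1 * ‖(ContinuousLinearMap.lsmul ℝ ℝ (E := ℝ)).flip‖ * μ.variation.real Set.univ, ?_⟩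
    rintro r ⟨g, hg, rfl⟩
    have hg1 : ∀ᵐ x ∂μ.variation, ‖g x‖ ≤ 1 := ae_of_all _ fun x =>
      (g.toBCF.norm_coe_le_norm x).trans hg
    exact VectorMeasure.norm_integral_le_of_norm_le_const
      (B := (ContinuousLinearMap.lsmul ℝ ℝ (E := ℝ)).flip) hg1
  have hpos : 0 < ‖h‖ + 1 := by positivity
  have hmem : |∫ᵛ u, ((‖h‖ + 1)⁻¹ • h) u ∂<•μ| ≤ tvNorm μ := by
    refine le_csSup hbdd ⟨(‖h‖ + 1)⁻¹ • h, ?_, rfl⟩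
    rw [norm_smul, Real.norm_of_nonneg (by positivity), inv_mul_le_one₀ hpos]
    linarith
  have hsmul : ∫ᵛ u, ((‖h‖ + 1)⁻¹ • h) u ∂<•μ = (‖h‖ + 1)⁻¹ * ∫ᵛ u, h u ∂<•μ :=
    VectorMeasure.integral_smul _ _ _ (‖h‖ + 1)⁻¹
  rwa [hsmul, abs_mul, abs_of_pos (inv_pos.2 hpos), inv_mul_le_iff₀ hpos] at hmem

theorem tendsto_noiseDensity_cocompact {σ : ℝ} (hσ : 0 < σ) :
    Tendsto (noiseDensity σ) (cocompact ℝ) (𝓝 0) := by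
  have h1 : Tendsto (fun z : ℝ => (σ⁻¹ * z) ^ 2 / 2) (cocompact ℝ) atTop := by
    have h2 : Tendsto (fun z : ℝ => ‖z‖) (cocompact ℝ) atTop := tendsto_norm_cocompact_atTop
    have h3 := ((h2.const_mul_atTop (inv_pos.2 hσ)).atTop_mul_atTop₀
      (h2.const_mul_atTop (inv_pos.2 hσ))).atTop_div_const (two_pos)
    refine h3.congr fun z => ?_
    rw [← sq, mul_pow, mul_pow, Real.norm_eq_abs, sq_abs]
  rw [noiseDensity_eq hσ]
  simp_rw [stdNormalPdf_apply]
  simpa using ((Real.tendsto_exp_neg_atTop_nhds_zero.comp h1).const_mul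
    (√(2 * Real.pi))⁻¹).const_mul σ⁻¹

/-- The integrand `g(u) f_V(y - u)` of a Tweedie functional, as an element of `C₀(ℝ)`. -/
noncomputable def tweedieKernel {σ : ℝ} (hσ : 0 < σ) (n : ℕ) (x y : ℝ) :
    ZeroAtInftyContinuousMap ℝ ℝ where
  toFun u := smoothedIndicator n x u * noiseDensity σ (y - u)
  continuous_toFun := (continuous_smoothedIndicator n x).mul
    ((contDiff_noiseDensity hσ).continuous.comp (continuous_const.sub continuous_id))
  zero_at_infty' := by
    have h1 : Tendsto (fun u => noiseDensity σ (y - u)) (cocompact ℝ) (𝓝 0) :=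
      (tendsto_noiseDensity_cocompact hσ).comp
        (Homeomorph.subLeft y).isClosedEmbedding.tendsto_cocompact
    refine squeeze_zero_norm (fun u => ?_) (by simpa using h1.norm)
    rw [norm_mul]
    exact mul_le_of_le_one_left (norm_nonneg _) (abs_smoothedIndicator_le_one n x u)

theorem convNoise_mixing {σ : ℝ} (f : admissible σ) : convNoise σ (mixing f) = f :=
  f.2.choose_spec

theorem mixture_mixing {σ : ℝ} (f : admissible σ) : mixture σ (mixing f) = f :=
  Subtype.ext (convNoise_mixing f)

/-- The Tweedie series as a linear functional on the admissible functions. -/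
noncomputable def seriesFunctional {σ : ℝ} (hσ : 0 < σ) {n : ℕ} (hn : 1 ≤ n) (x y : ℝ) :
    admissible σ →ₗ[ℝ] ℝ where
  toFun f := ∑' k, seriesTerm σ n x y f k
  map_add' f g := by
    rw [← convNoise_mixing f, ← convNoise_mixing g, ← (hasSum_seriesTerm_convNoise hσ hn x y
      (mixing f)).summable.tsum_add (hasSum_seriesTerm_convNoise hσ hn x y (mixing g)).summable]
    refine tsum_congr fun k => ?_
    rw [Submodule.coe_add, seriesTerm_eq, seriesTerm_eq, seriesTerm_eq, convNoise_mixing,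
      convNoise_mixing, iteratedDeriv_add, mul_add]
    all_goals
      rw [← convNoise_mixing]
      exact ((contDiff_convNoise hσ _).of_le (by exact_mod_cast le_top)).contDiffAt
  map_smul' c f := by
    rw [RingHom.id_apply, smul_eq_mul, ← tsum_mul_left]
    refine tsum_congr fun k => ?_
    rw [Submodule.coe_smul, seriesTerm_eq, seriesTerm_eq, iteratedDeriv_const_smul_field,
      smul_eq_mul]
    ring

theorem isTweedieFunctional_seriesFunctional {σ : ℝ} (hσ : 0 < σ) {n : ℕ} (hn : 1 ≤ n)
    (x y : ℝ) :
    IsTweedieFunctional σ (smoothedIndicator n x) y (seriesFunctional hσ hn x y) := by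
  have happ : ∀ μ : SignedMeasure ℝ, seriesFunctional hσ hn x y (mixture σ μ) =
      ∫ᵛ u, smoothedIndicator n x u * noiseDensity σ (y - u) ∂<•μ := fun μ =>
    (hasSum_seriesTerm_convNoise hσ hn x y μ).tsum_eq
  refine ⟨⟨‖tweedieKernel hσ n x y‖ + 1, fun f => ?_⟩, happ⟩
  conv_lhs => rw [← mixture_mixing f, happ]
  exact abs_integral_le_mul_tvNorm (mixing f) (tweedieKernel hσ n x y)

theorem IsTweedieFunctional.eq {σ : ℝ} {g : ℝ → ℝ} {y : ℝ} {T T' : admissible σ →ₗ[ℝ] ℝ}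
    (hT : IsTweedieFunctional σ g y T) (hT' : IsTweedieFunctional σ g y T') : T = T' := by
  ext f
  rw [← mixture_mixing f, hT.apply_mixture, hT'.apply_mixture]

/-! ### The posterior distribution -/

theorem noiseDensity_pos {σ : ℝ} (hσ : 0 < σ) (z : ℝ) : 0 < noiseDensity σ z :=
  gaussianPDFReal_pos _ _ _ (by simpa using hσ.ne')

theorem observedDensity_apply (σ : ℝ) (PX : Measure ℝ) [IsFiniteMeasure PX] (y : ℝ) :
    observedDensity σ PX y = ∫ u, noiseDensity σ (y - u) ∂PX :=
  VectorMeasure.integral_toSignedMeasure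

theorem integrable_noiseDensity_sub_measure (σ y : ℝ) (PX : Measure ℝ) [IsFiniteMeasure PX] :
    Integrable (fun u => noiseDensity σ (y - u)) PX := by
  obtain ⟨C, hC⟩ := abs_noiseDensity_le σ
  exact Integrable.of_bound ((measurable_noiseDensity σ).comp
    (measurable_const.sub measurable_id)).aestronglyMeasurable C (ae_of_all _ fun _ => hC _)

theorem observedDensity_pos {σ : ℝ} (hσ : 0 < σ) (PX : Measure ℝ) [IsProbabilityMeasure PX]
    (y : ℝ) : 0 < observedDensity σ PX y := by
  rw [observedDensity_apply, integral_pos_iff_support_of_nonneg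
    (fun u => (noiseDensity_pos hσ _).le) (integrable_noiseDensity_sub_measure σ y PX)]
  have : (Function.support fun u => noiseDensity σ (y - u)) = Set.univ :=
    Set.eq_univ_of_forall fun u => (noiseDensity_pos hσ _).ne'
  simp [this]

theorem ofReal_observedDensity {σ : ℝ} (hσ : 0 < σ) (PX : Measure ℝ) [IsFiniteMeasure PX]
    (y : ℝ) : ENNReal.ofReal (observedDensity σ PX y) =
      ∫⁻ u, ENNReal.ofReal (noiseDensity σ (y - u)) ∂PX := by
  rw [observedDensity_apply, ofReal_integral_eq_lintegral_ofReal
    (integrable_noiseDensity_sub_measure σ y PX) (ae_of_all _ fun _ => (noiseDensity_pos hσ _).le)]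

theorem measurable_ofReal_observedDensity {σ : ℝ} (hσ : 0 < σ) (PX : Measure ℝ)
    [IsFiniteMeasure PX] :
    Measurable fun y => ENNReal.ofReal (observedDensity σ PX y) := by
  simp_rw [ofReal_observedDensity hσ]
  have := measurable_noiseDensity σ
  exact Measurable.lintegral_prod_right (by fun_prop)

/-- The joint law of `(X + V, X)` has density `f_V(y - u)` with respect to `dy dP_X(u)`. -/
theorem lintegral_map_add_prodMk {Ω : Type*} [MeasurableSpace Ω] {σ : ℝ} (hσ : 0 < σ)
    (P : Measure Ω) [IsProbabilityMeasure P] {X V : Ω → ℝ} (hX : AEMeasurable X P)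
    (hV : HasLaw V (gaussianReal 0 (σ ^ 2).toNNReal) P) (hXV : IndepFun X V P)
    {F : ℝ × ℝ → ENNReal} (hF : Measurable F) :
    ∫⁻ p, F p ∂(P.map fun a => (X a + V a, X a)) =
      ∫⁻ y, ∫⁻ u, F (y, u) * ENNReal.ofReal (noiseDensity σ (y - u)) ∂(P.map X) := by
  have hnd := measurable_noiseDensity σ
  have := Measure.isProbabilityMeasure_map hX
  have hprod := (indepFun_iff_map_prod_eq_prod_map_map hX hV.aemeasurable).1 hXV
  rw [hV.map_eq] at hprod
  have hcomp : (P.map fun a => (X a + V a, X a)) =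
      (P.map fun a => (X a, V a)).map fun p : ℝ × ℝ => (p.1 + p.2, p.1) := by
    rw [AEMeasurable.map_map_of_aemeasurable (by fun_prop) (hX.prodMk hV.aemeasurable)]
    rfl
  rw [hcomp, lintegral_map hF (by fun_prop), hprod, lintegral_prod _ (by fun_prop)]
  conv_rhs => rw [lintegral_lintegral_swap (by fun_prop)]
  refine lintegral_congr fun u => ?_
  rw [gaussianReal_of_var_ne_zero _ (by simpa using hσ.ne'),
    lintegral_withDensity_eq_lintegral_mul _ (by fun_prop) (by fun_prop),
    ← lintegral_sub_right_eq_self _ u]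
  refine lintegral_congr fun y => ?_
  simp only [Pi.mul_apply, gaussianPDF, noiseDensity, add_sub_cancel]
  rw [mul_comm]

theorem map_add_eq_withDensity {Ω : Type*} [MeasurableSpace Ω] {σ : ℝ} (hσ : 0 < σ)
    (P : Measure Ω) [IsProbabilityMeasure P] {X V : Ω → ℝ} (hX : AEMeasurable X P)
    (hV : HasLaw V (gaussianReal 0 (σ ^ 2).toNNReal) P) (hXV : IndepFun X V P) :
    P.map (fun a => X a + V a) =
      volume.withDensity fun y => ENNReal.ofReal (observedDensity σ (P.map X) y) := by
  have hnd := measurable_noiseDensity σ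
  have hVm := hV.aemeasurable
  refine Measure.ext_of_lintegral _ fun F hF => ?_
  have hfst : P.map (fun a => X a + V a) = (P.map fun a => (X a + V a, X a)).map Prod.fst := by
    rw [AEMeasurable.map_map_of_aemeasurable (by fun_prop) (by fun_prop)]
    rfl
  rw [hfst, lintegral_map hF measurable_fst,
    lintegral_map_add_prodMk hσ P hX hV hXV (F := fun p => F p.1) (hF.comp measurable_fst),
    lintegral_withDensity_eq_lintegral_mul _ (measurable_ofReal_observedDensity hσ _) hF]
  refine lintegral_congr fun y => ?_
  rw [Pi.mul_apply, ofReal_observedDensity hσ, mul_comm, ← lintegral_const_mul _ (by fun_prop)]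

/-- Bayes' formula: the kernel `y ↦ f_V(y - u) / f_Y(y) dP_X(u)`, with the quotient taken in
`[0, ∞]`. -/
noncomputable def posteriorKernel (σ : ℝ) (PX : Measure ℝ) [IsFiniteMeasure PX] : Kernel ℝ ℝ :=
  (Kernel.const ℝ PX).withDensity fun y u =>
    ENNReal.ofReal (noiseDensity σ (y - u)) / ENNReal.ofReal (observedDensity σ PX y)

theorem posteriorKernel_apply {σ : ℝ} (hσ : 0 < σ) (PX : Measure ℝ) [IsFiniteMeasure PX] (y : ℝ) :
    posteriorKernel σ PX y = PX.withDensity fun u =>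
      ENNReal.ofReal (noiseDensity σ (y - u)) / ENNReal.ofReal (observedDensity σ PX y) := by
  have := measurable_noiseDensity σ
  have hod := measurable_ofReal_observedDensity hσ PX
  have hm : Measurable fun p : ℝ × ℝ => ENNReal.ofReal (noiseDensity σ (p.1 - p.2)) := by fun_prop
  rw [posteriorKernel, Kernel.withDensity_apply _ (hm.div (hod.comp measurable_fst)),
    Kernel.const_apply]

theorem isMarkovKernel_posteriorKernel {σ : ℝ} (hσ : 0 < σ) (PX : Measure ℝ)
    [IsProbabilityMeasure PX] : IsMarkovKernel (posteriorKernel σ PX) := by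
  have := measurable_noiseDensity σ
  refine ⟨fun y => ⟨?_⟩⟩
  simp_rw [posteriorKernel_apply hσ, withDensity_apply _ MeasurableSet.univ,
    Measure.restrict_univ, div_eq_mul_inv]
  rw [lintegral_mul_const _ (by fun_prop), ← ofReal_observedDensity hσ]
  exact ENNReal.mul_inv_cancel (ENNReal.ofReal_pos.2 (observedDensity_pos hσ PX y)).ne'
    ENNReal.ofReal_ne_top

theorem real_posteriorKernel_Iic {σ : ℝ} (hσ : 0 < σ) (PX : Measure ℝ)
    [IsProbabilityMeasure PX] (x y : ℝ) :
    (posteriorKernel σ PX y).real (Set.Iic x) = posteriorCdf σ PX x y := by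
  have := measurable_noiseDensity σ
  simp_rw [measureReal_def, posteriorKernel_apply hσ, withDensity_apply _ measurableSet_Iic,
    div_eq_mul_inv]
  rw [lintegral_mul_const _ (by fun_prop), ENNReal.toReal_mul, ENNReal.toReal_inv,
    ENNReal.toReal_ofReal (observedDensity_pos hσ PX y).le, posteriorCdf, div_eq_mul_inv,
    integral_eq_lintegral_of_nonneg_ae (ae_of_all _ fun _ => (noiseDensity_pos hσ _).le)
      (by fun_prop : Measurable _).aestronglyMeasurable]

theorem condDistrib_add_ae_eq {Ω : Type*} [MeasurableSpace Ω] {σ : ℝ} (hσ : 0 < σ)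
    (P : Measure Ω) [IsProbabilityMeasure P] {X V : Ω → ℝ} (hX : AEMeasurable X P)
    (hV : HasLaw V (gaussianReal 0 (σ ^ 2).toNNReal) P) (hXV : IndepFun X V P) :
    condDistrib X (fun a => X a + V a) P =ᵐ[P.map fun a => X a + V a]
      posteriorKernel σ (P.map X) := by
  have := Measure.isProbabilityMeasure_map hX
  have := isMarkovKernel_posteriorKernel hσ (P.map X)
  have hnd := measurable_noiseDensity σ
  have hVm := hV.aemeasurable
  have hod := measurable_ofReal_observedDensity hσ (P.map X)
  have : IsProbabilityMeasure (P.map fun a => X a + V a) :=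
    Measure.isProbabilityMeasure_map (hX.add hVm)
  refine condDistrib_ae_eq_of_measure_eq_compProd _ hX (Measure.ext_of_lintegral _ fun F hF => ?_)
  rw [lintegral_map_add_prodMk hσ P hX hV hXV hF, Measure.lintegral_compProd hF]
  have hFk : Measurable fun y => ∫⁻ u, F (y, u) ∂posteriorKernel σ (P.map X) y :=
    hF.lintegral_kernel_prod_right'
  rw [map_add_eq_withDensity hσ P hX hV hXV, lintegral_withDensity_eq_lintegral_mul _ hod hFk]
  refine lintegral_congr fun y => ?_
  have hpos := (ENNReal.ofReal_pos.2 (observedDensity_pos hσ (P.map X) y)).ne'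
  rw [Pi.mul_apply, posteriorKernel_apply hσ,
    lintegral_withDensity_eq_lintegral_mul _ (by fun_prop) (by fun_prop),
    ← lintegral_const_mul _ (by fun_prop)]
  refine lintegral_congr fun u => ?_
  rw [Pi.mul_apply, ← mul_assoc, ENNReal.mul_div_cancel hpos ENNReal.ofReal_ne_top, mul_comm]

/-! ### Removing the smoothing -/

theorem tendsto_natCast_rpow_neg_half :
    Tendsto (fun n : ℕ => (n : ℝ) ^ (-(1 / 2) : ℝ)) atTop (𝓝 0) :=
  (tendsto_rpow_neg_atTop (by norm_num)).comp tendsto_natCast_atTop_atTop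

/-- The shift `n^{-1/2}` dominates the width `n⁻¹` of the smoothing, so that the limit is the
indicator of the closed half-line, with value `1` at `u = x`. -/
theorem tendsto_smoothedIndicator (x u : ℝ) :
    Tendsto (fun n : ℕ => smoothedIndicator n x u) atTop
      (𝓝 ((Set.Iic x).indicator (fun _ => 1) u)) := by
  have hcast : Tendsto (fun n : ℕ => (n : ℝ)) atTop atTop := tendsto_natCast_atTop_atTop
  by_cases hu : u ≤ x
  · rw [Set.indicator_of_mem (Set.mem_Iic.2 hu)]
    have hroot : Tendsto (fun n : ℕ => (n : ℝ) ^ (1 / 2 : ℝ)) atTop atTop :=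
      (tendsto_rpow_atTop (by norm_num)).comp hcast
    have harg : Tendsto (fun n : ℕ => (x + (n : ℝ) ^ (-(1 / 2) : ℝ) - u) / (n : ℝ)⁻¹)
        atTop atTop := by
      refine tendsto_atTop_mono' _ ?_ hroot
      filter_upwards [eventually_gt_atTop 0] with n hn
      have hn' : (0 : ℝ) < n := by exact_mod_cast hn
      have hpow : (n : ℝ) ^ (1 / 2 : ℝ) = (n : ℝ) ^ (-(1 / 2) : ℝ) / (n : ℝ)⁻¹ := by
        rw [div_inv_eq_mul, ← Real.rpow_add_one hn'.ne']
        norm_num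
      rw [hpow]
      gcongr
      linarith
    exact (tendsto_cdf_atTop (gaussianReal 0 1)).comp harg
  · rw [Set.indicator_of_notMem (by simpa using hu)]
    have h1 : Tendsto (fun n : ℕ => x + (n : ℝ) ^ (-(1 / 2) : ℝ) - u) atTop (𝓝 (x - u)) := by
      simpa using (tendsto_natCast_rpow_neg_half.const_add x).sub_const u
    have harg : Tendsto (fun n : ℕ => (x + (n : ℝ) ^ (-(1 / 2) : ℝ) - u) / (n : ℝ)⁻¹)
        atTop atBot := by
      simp_rw [div_inv_eq_mul]
      exact h1.neg_mul_atTop (by linarith [not_le.1 hu]) hcast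
    exact (tendsto_cdf_atBot (gaussianReal 0 1)).comp harg

theorem hasSum_seriesTerm_observedDensity {σ : ℝ} (hσ : 0 < σ) {n : ℕ} (hn : 1 ≤ n) (x y : ℝ)
    (PX : Measure ℝ) [IsFiniteMeasure PX] :
    HasSum (seriesTerm σ n x y (observedDensity σ PX))
      (∫ u, smoothedIndicator n x u * noiseDensity σ (y - u) ∂PX) := by
  rw [← VectorMeasure.integral_toSignedMeasure]
  exact hasSum_seriesTerm_convNoise hσ hn x y _

theorem tendsto_tsum_seriesTerm_observedDensity {σ : ℝ} (hσ : 0 < σ) (x y : ℝ)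
    (PX : Measure ℝ) [IsFiniteMeasure PX] :
    Tendsto (fun n : ℕ => ∑' k, seriesTerm σ n x y (observedDensity σ PX) k) atTop
      (𝓝 (∫ u in Set.Iic x, noiseDensity σ (y - u) ∂PX)) := by
  have hm := measurable_noiseDensity σ
  have hlim : Tendsto (fun n : ℕ => ∫ u, smoothedIndicator n x u * noiseDensity σ (y - u) ∂PX)
      atTop (𝓝 (∫ u, (Set.Iic x).indicator (fun _ => 1) u * noiseDensity σ (y - u) ∂PX)) := by
    refine tendsto_integral_of_dominated_convergence (fun u => noiseDensity σ (y - u))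
      (fun n => ?_) (integrable_noiseDensity_sub_measure σ y PX)
      (fun n => ae_of_all _ fun u => ?_)
      (ae_of_all _ fun u => (tendsto_smoothedIndicator x u).mul_const _)
    · exact ((continuous_smoothedIndicator n x).measurable.mul
        (hm.comp (measurable_const.sub measurable_id))).aestronglyMeasurable
    · rw [norm_mul, Real.norm_of_nonneg (noiseDensity_pos hσ _).le]
      exact mul_le_of_le_one_left (noiseDensity_pos hσ _).le (abs_smoothedIndicator_le_one n x u)
  have hind : ∫ u, (Set.Iic x).indicator (fun _ => 1) u * noiseDensity σ (y - u) ∂PX =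
      ∫ u in Set.Iic x, noiseDensity σ (y - u) ∂PX := by
    rw [← integral_indicator measurableSet_Iic]
    congr 1 with u
    by_cases hu : u ∈ Set.Iic x <;> simp [hu]
  rw [← hind]
  refine hlim.congr' ?_
  filter_upwards [eventually_ge_atTop 1] with n hn
  exact (hasSum_seriesTerm_observedDensity hσ hn x y PX).tsum_eq.symm

theorem tendsto_seriesTerm_zero {σ : ℝ} (hσ : 0 < σ) (x y : ℝ) (f : ℝ → ℝ) :
    Tendsto (fun n : ℕ => seriesTerm σ n x y f 0) atTop (𝓝 (Phi ((x - y) / σ) * f y)) := by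
  have hz : Tendsto (fun n : ℕ => (n : ℝ) ^ (-2 : ℤ)) atTop (𝓝 0) :=
    (tendsto_zpow_atTop_zero (by norm_num)).comp tendsto_natCast_atTop_atTop
  have hs : Tendsto (fun n : ℕ => √(σ ^ 2 + (n : ℝ) ^ (-2 : ℤ))) atTop (𝓝 σ) := by
    have h := (Real.continuous_sqrt.tendsto _).comp (hz.const_add (σ ^ 2))
    rwa [add_zero, Real.sqrt_sq hσ.le] at h
  have hx : Tendsto (fun n : ℕ => x + (n : ℝ) ^ (-(1 / 2) : ℝ) - y) atTop (𝓝 (x - y)) := by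
    simpa using (tendsto_natCast_rpow_neg_half.const_add x).sub_const y
  have h := ((continuous_Phi.tendsto _).comp (hx.div hs hσ.ne')).mul_const (f y)
  simpa [seriesTerm, Function.comp_def] using h

end Tweedie

theorem mainTheorem11 (σ : ℝ) (hσ : 0 < σ) :
    (∀ (n : ℕ), 1 ≤ n → ∀ x y : ℝ,
      (∃! T : Tweedie.admissible σ →ₗ[ℝ] ℝ,
        Tweedie.IsTweedieFunctional σ (Tweedie.smoothedIndicator n x) y T) ∧
      ∀ T : Tweedie.admissible σ →ₗ[ℝ] ℝ,
        Tweedie.IsTweedieFunctional σ (Tweedie.smoothedIndicator n x) y T →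
        ∀ f : Tweedie.admissible σ,
          ContDiff ℝ ∞ (f : ℝ → ℝ) ∧
          Summable (fun k : ℕ => |Tweedie.seriesTerm σ n x y f k|) ∧
          T f = ∑' k : ℕ, Tweedie.seriesTerm σ n x y f k) ∧
    (∀ (Ω : Type*) [MeasurableSpace Ω] (P : Measure Ω) [IsProbabilityMeasure P]
      (X V : Ω → ℝ), AEMeasurable X P → HasLaw V (gaussianReal 0 (σ ^ 2).toNNReal) P →
      IndepFun X V P →
      (P.map (fun a => X a + V a) =
        volume.withDensity fun y => ENNReal.ofReal (Tweedie.observedDensity σ (P.map X) y)) ∧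
      (∀ y, 0 < Tweedie.observedDensity σ (P.map X) y) ∧
      (∀ᵐ y ∂(P.map fun a => X a + V a), ∀ x : ℝ,
        (condDistrib X (fun a => X a + V a) P y).real (Set.Iic x) =
          Tweedie.posteriorCdf σ (P.map X) x y) ∧
      ∀ x y : ℝ,
        Tendsto (fun n : ℕ =>
            (1 / Tweedie.observedDensity σ (P.map X) y) *
              ∑' k : ℕ, Tweedie.seriesTerm σ n x y (Tweedie.observedDensity σ (P.map X)) k)
          atTop (𝓝 (Tweedie.posteriorCdf σ (P.map X) x y)) ∧
        ∃ L : ℝ,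
          Tendsto (fun n : ℕ => ∑' k : ℕ,
              Tweedie.seriesTerm σ n x y (Tweedie.observedDensity σ (P.map X)) (k + 1))
            atTop (𝓝 L) ∧
          Tweedie.posteriorCdf σ (P.map X) x y =
            Tweedie.Phi ((x - y) / σ) + (1 / Tweedie.observedDensity σ (P.map X) y) * L) := by
  refine ⟨fun n hn x y => ⟨⟨Tweedie.seriesFunctional hσ hn x y,
    Tweedie.isTweedieFunctional_seriesFunctional hσ hn x y, fun T hT =>
      hT.eq (Tweedie.isTweedieFunctional_seriesFunctional hσ hn x y)⟩, fun T hT f => ?_⟩,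
    fun Ω _ P _ X V hX hV hXV => ?_⟩
  · refine ⟨?_, ?_, ?_⟩
    · rw [← Tweedie.convNoise_mixing f]
      exact Tweedie.contDiff_convNoise hσ _
    · rw [← Tweedie.convNoise_mixing f]
      exact (Tweedie.hasSum_seriesTerm_convNoise hσ hn x y _).summable.abs
    · rw [hT.eq (Tweedie.isTweedieFunctional_seriesFunctional hσ hn x y)]
      rfl
  · have := Measure.isProbabilityMeasure_map hX
    have hpos := Tweedie.observedDensity_pos hσ (P.map X)
    refine ⟨Tweedie.map_add_eq_withDensity hσ P hX hV hXV, hpos, ?_, fun x y => ?_⟩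
    · filter_upwards [Tweedie.condDistrib_add_ae_eq hσ P hX hV hXV] with y hy x
      rw [hy, Tweedie.real_posteriorKernel_Iic hσ]
    · have hlim := Tweedie.tendsto_tsum_seriesTerm_observedDensity hσ x y (P.map X)
      have hzero := Tweedie.tendsto_seriesTerm_zero hσ x y
        (Tweedie.observedDensity σ (P.map X))
      -- `L` is the limit of the whole series minus the limit of its zeroth term
      refine ⟨?_, _, (hlim.sub hzero).congr' ?_, ?_⟩
      · have hpost : Tweedie.posteriorCdf σ (P.map X) x y =
            1 / Tweedie.observedDensity σ (P.map X) y *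
              ∫ u in Set.Iic x, Tweedie.noiseDensity σ (y - u) ∂(P.map X) := by
          rw [Tweedie.posteriorCdf, one_div_mul_eq_div]
        rw [hpost]
        exact hlim.const_mul _
      · filter_upwards [eventually_ge_atTop 1] with n hn
        rw [(Tweedie.hasSum_seriesTerm_observedDensity hσ hn x y
          (P.map X)).summable.tsum_eq_zero_add,
          add_sub_cancel_left]
      · have := (hpos y).ne'
        rw [Tweedie.posteriorCdf]
        field_simp
        ring
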